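/- **Setting.** All registers are finite-dimensional, and a channel is a completely positive trace-preserving (CPTP) map. Let $\mathsf{Cliff}$ be the finite set of single-qubit Clifford gates, regarded as unitary channels $\rho\mapsto U\rho U^\dagger$, where $U$ is a unitary for which conjugation maps each of the Pauli matrices $X,Y,Z$ to one of $\pm X,\pm Y,\pm Z$. Let $\mathsf{X}=\{|0\rangle,|1\rangle,|+\rangle,|-\rangle,|{+i}\rangle,|{-i}\rangle\}$ be the six Pauli eigenstates, and let $d\psi$ be the Haar probability measure on pure qubit states. Let $k$ be the maximal depth of the test. **Strategies of the provers $A$ and $B$.** The holder of the state at time step $\kappa$ is $A$ if $\kappa$ is even and $B$ if $\kappa$ is odd. Initially $A$ receives the verifier's qubit $\psi$. Besides it, the provers share an arbitrary state $\tau$, independent of $\psi$, on a private register of $A$ and a register of $B$. In round $j=1,\dots,k$ they apply an arbitrary joint channel $\mathcal E_{\vec c_j,j}$ from their registers $A_{j-1}B_{j-1}$ to their registers $A_jB_j$; it may depend on the gates $\vec c_j=(C_1,\dots,C_j)$ announced up to round $j$, but not on the depth of the test, which has not been revealed. If the verifier asks for the output at time step $\kappa$, the holder applies a local channel, which may depend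 on $\vec c_\kappa$, to his or her own registers and returns the resulting qubit. Write $$\rho^\psi_{\vec c_\kappa,\kappa}=\mathcal E_{\vec c_\kappa,\kappa}\circ\cdots\circ\mathcal E_{\vec c_1,1}(|\psi\rangle\langle\psi|\otimes\tau)$$ for the joint state at time step $\kappa$ before any output (so $\rho^\psi_{\vec c_0,0}=|\psi\rangle\langle\psi|\otimes\tau$), and $\mathcal Q_{\vec c_\kappa,\kappa}$ for the resulting channel from the verifier's qubit to the returned qubit. **The test.** The depth $\kappa\in\{1,\dots,k\}$, the state $\psi\in\mathsf X$ and the gates $\vec c_\kappa\in\mathsf{Cliff}^\kappa$ are uniformly random, and the verifier accepts by projecting the returned qubit onto $C_\kappa\circ\cdots\circ C_1(|\psi\rangle\langle\psi|)$. The average success probability is $$P=\frac1k\sum_{\kappa=1}^k\frac1{6}\sum_{\psi\in\mathsf X}\frac1{|\mathsf{Cliff}|^\kappa}\sum_{\vec c_\kappa\in\mathsf{Cliff}^\kappa}\mathrm{Tr}\big[\mathcal Q_{\vec c_\kappa,\kappa}(|\psi\rangle\langle\psi|)\;C_\kappa\circ\cdots\circ C_1(|\psi\rangle\langle\psi|)\big].$$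 **Exact sending channels.** Let $\mathcal E$ be a channel from joint registers $A_0B_0$ to joint registers $A_1B_1$, where $B_1$ consists of all registers of $B$ afterwards; this includes a channel from $A_0$ to new registers of $B$, applied while $B$ keeps $B_0$. It is an *exact sending channel* from $A$ to $B$ if there is a channel $\Omega$ from a qubit to $A_0B_0$ such that $$\sup_{\Gamma}\int d\psi\,\langle\psi|\,\Gamma\big(\mathrm{Tr}_{A_1}\,\mathcal E(\Omega(|\psi\rangle\langle\psi|))\big)\,|\psi\rangle=1\quad\text{and}\quad \sup_{\Gamma}\int d\psi\,\langle\psi|\,\Gamma\big(\mathrm{Tr}_{A_0}\,\Omega(|\psi\rangle\langle\psi|)\big)\,|\psi\rangle=\tfrac12,$$ where the suprema run over all channels $\Gamma$ from $B_1$, respectively $B_0$, to a qubit. Exact sending from $B$ to $A$ is defined with the roles exchanged. **Theorem (exact soundness).** Suppose that $P=1$. Then: 1. For every $1\le\kappa\le k$ and every $\vec c_\kappa\in\mathsf{Cliff}^\kappa$, $\mathcal Q_{\vec c_\kappa,\kappa}=C_\kappa\circ\cdots\circ C_1$. That is, the provers return the correct Clifford-rotated state at every depth, for every input state. 2. The provers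 use an exact sending channel in each of the $k$ rounds: for every $1\le j\le k$ and every $\vec c_j\in\mathsf{Cliff}^j$, $\mathcal E_{\vec c_j,j}$ is an exact sending channel to the holder at time step $j$ (from $A$ to $B$ for odd $j$, from $B$ to $A$ for even $j$). Moreover, the two equalities of the definition hold with $\Omega$ equal to the provers' actual state map $|\psi\rangle\langle\psi|\mapsto\rho^\psi_{\vec c_{j-1},j-1}$. -/

import Mathlib

open MeasureTheory
open scoped ComplexOrder

namespace PingPong

noncomputable section

/-! ### Finite-dimensional quantum systems and channels -/

/-- Operators on a quantum register whose Hilbert space has orthonormal basis indexed by `n`. -/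
abbrev Op (n : Type*) : Type _ := Matrix n n ℂ

/-- The index type of a single qubit. -/
abbrev Qubit : Type := Fin 2

/-- A density operator: positive semidefinite with unit trace. -/
def IsState {n : Type*} [Fintype n] (ρ : Op n) : Prop :=
  ρ.PosSemidef ∧ ρ.trace = 1

/-- The map `Φ ⊗ id` on the operators of the composite register `m × r`. -/
def ampliate {m n : Type*} (Φ : Op m →ₗ[ℂ] Op n) (r : Type*) (M : Op (m × r)) : Op (n × r) :=
  Matrix.of fun x y => Φ (Matrix.of fun i j => M (i, x.2) (j, y.2)) x.1 y.1

/-- Complete positivity: `Φ ⊗ id_r` preserves positivity for every finite-dimensional ancilla. -/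
def IsCompletelyPositive {m n : Type*} (Φ : Op m →ₗ[ℂ] Op n) : Prop :=
  ∀ (r : ℕ) (M : Op (m × Fin r)), M.PosSemidef → (ampliate Φ (Fin r) M).PosSemidef

/-- Quantum channels: completely positive trace-preserving maps. -/
def IsCPTP {m n : Type*} [Fintype m] [Fintype n] (Φ : Op m →ₗ[ℂ] Op n) : Prop :=
  IsCompletelyPositive Φ ∧ ∀ M, (Φ M).trace = M.trace

/-! ### Pure qubit states and average fidelity -/

/-- The operator `|v⟩⟨v|`. -/
def ketbra (v : EuclideanSpace ℂ Qubit) : Op Qubit :=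
  Matrix.of fun i j => v i * star (v j)

/-- The six Pauli eigenstates `|0⟩, |1⟩, |+⟩, |-⟩, |+i⟩, |-i⟩`. -/
def pauliKet : Fin 6 → EuclideanSpace ℂ Qubit :=
  ![!₂[1, 0],
    !₂[0, 1],
    !₂[((√2 : ℝ) : ℂ)⁻¹, ((√2 : ℝ) : ℂ)⁻¹],
    !₂[((√2 : ℝ) : ℂ)⁻¹, -((√2 : ℝ) : ℂ)⁻¹],
    !₂[((√2 : ℝ) : ℂ)⁻¹, Complex.I * ((√2 : ℝ) : ℂ)⁻¹],
    !₂[((√2 : ℝ) : ℂ)⁻¹, -(Complex.I * ((√2 : ℝ) : ℂ)⁻¹)]]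

/-- The set of unit vectors of the qubit Hilbert space. -/
abbrev PureQubit : Type := Metric.sphere (0 : EuclideanSpace ℂ Qubit) 1

/-- The Haar (uniform, unitarily invariant) probability measure on pure qubit states, realised as
the normalised surface measure of the unit sphere of `ℂ²`. -/
def haarPure : Measure PureQubit :=
  ((volume : Measure (EuclideanSpace ℂ Qubit)).toSphere Set.univ)⁻¹ •
    (volume : Measure (EuclideanSpace ℂ Qubit)).toSphere

/-- The average fidelity `∫ dψ Tr[Λ(|ψ⟩⟨ψ|) |ψ⟩⟨ψ|]`. -/
def avgFidelity (Λ : Op Qubit →ₗ[ℂ] Op Qubit) : ℝ :=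
  ∫ ψ : PureQubit, (Λ (ketbra ψ) * ketbra ψ).trace.re ∂haarPure

/-! ### Clifford gates -/

/-- The Pauli matrices `X, Y, Z`. -/
def pauli : Fin 3 → Op Qubit :=
  ![!![0, 1; 1, 0], !![0, -Complex.I; Complex.I, 0], !![1, 0; 0, -1]]

/-- Conjugation `M ↦ U M U†`. -/
def conjBy (U : Op Qubit) : Op Qubit →ₗ[ℂ] Op Qubit where
  toFun M := U * M * U.conjTranspose
  map_add' M N := by rw [Matrix.mul_add, Matrix.add_mul]
  map_smul' c M := by simp

/-- A unitary is Clifford if conjugation by it maps Pauli matrices to Pauli matrices up to sign. -/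
def IsClifford (U : Op Qubit) : Prop :=
  U ∈ Matrix.unitaryGroup Qubit ℂ ∧
    ∀ i, ∃ j, conjBy U (pauli i) = pauli j ∨ conjBy U (pauli i) = -pauli j

/-- The single-qubit Clifford gates, as unitary channels (that is, Clifford unitaries up to a
global phase). -/
def Cliff : Type := {Φ : Op Qubit →ₗ[ℂ] Op Qubit // ∃ U, IsClifford U ∧ Φ = conjBy U}

theorem eq_of_agree_on_pauli {Φ Ψ : Op Qubit →ₗ[ℂ] Op Qubit} (h1 : Φ 1 = Ψ 1)
    (h : ∀ i, Φ (pauli i) = Ψ (pauli i)) : Φ = Ψ := by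
  refine LinearMap.ext fun M => ?_
  have hM : M = ((M 0 0 + M 1 1) / 2) • (1 : Op Qubit) + ((M 0 1 + M 1 0) / 2) • pauli 0
      + (Complex.I * (M 0 1 - M 1 0) / 2) • pauli 1 + ((M 0 0 - M 1 1) / 2) • pauli 2 := by
    ext i j
    fin_cases i <;> fin_cases j <;> simp [pauli] <;> ring_nf <;> simp <;> ring
  rw [hM]
  simp only [map_add, map_smul, h1, h]

instance : Finite Cliff := by
  let f : Cliff → Fin 3 → Op Qubit := fun Φ i => Φ.1 (pauli i)
  have hf : Function.Injective f := by
    rintro ⟨Φ, U, hU, rfl⟩ ⟨Ψ, V, hV, rfl⟩ h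
    refine Subtype.ext (eq_of_agree_on_pauli ?_ fun i => congrFun h i)
    have hu : U * U.conjTranspose = 1 := Matrix.mem_unitaryGroup_iff.mp hU.1
    have hv : V * V.conjTranspose = 1 := Matrix.mem_unitaryGroup_iff.mp hV.1
    simp [conjBy, hu, hv]
  have hfin : (Set.univ.pi fun _ : Fin 3 =>
      Set.range pauli ∪ Set.range fun i => -pauli i).Finite :=
    Set.Finite.pi fun _ => (Set.finite_range _).union (Set.finite_range _)
  have hr : (Set.range f).Finite := by
    refine hfin.subset ?_
    rintro _ ⟨⟨Φ, U, hU, rfl⟩, rfl⟩ i -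
    obtain ⟨j, hj | hj⟩ := hU.2 i
    · exact Or.inl ⟨j, hj.symm⟩
    · exact Or.inr ⟨j, hj.symm⟩
  exact Set.finite_univ_iff.mp
    (Set.Finite.of_finite_image (by simpa using hr) hf.injOn)

instance : Fintype Cliff := Fintype.ofFinite Cliff

/-- The ideal operation `C_κ ∘ ⋯ ∘ C_1` of a Clifford string. -/
def idealGate : (κ : ℕ) → (Fin κ → Cliff) → Op Qubit →ₗ[ℂ] Op Qubit
  | 0, _ => LinearMap.id
  | κ + 1, c => (c (Fin.last κ)).1 ∘ₗ idealGate κ (Fin.init c)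

/-! ### The two provers and sending channels -/

/-- The two provers. -/
inductive Party
  | A
  | B

/-- The prover who is to hold (and, if challenged, to output) the state after `κ` rounds. -/
def holder (κ : ℕ) : Party := if Even κ then Party.A else Party.B

/-- The joint register of the two provers. -/
abbrev Joint (r : Party → Type*) : Type _ := r Party.A × r Party.B

/-- The reduced operator on the registers of prover `p`: partial trace over the other prover. -/
def marginal {r : Party → Type*} [∀ p, Fintype (r p)] :
    (p : Party) → Op (Joint r) →ₗ[ℂ] Op (r p)
  | Party.A =>
    { toFun := fun M => Matrix.of fun i j => ∑ b, M (i, b) (j, b)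
      map_add' := fun M N => by ext i j; simp [Finset.sum_add_distrib]
      map_smul' := fun c M => by ext i j; simp [Finset.mul_sum] }
  | Party.B =>
    { toFun := fun M => Matrix.of fun i j => ∑ a, M (a, i) (a, j)
      map_add' := fun M N => by ext i j; simp [Finset.sum_add_distrib]
      map_smul' := fun c M => by ext i j; simp [Finset.mul_sum] }

/-- All average fidelities with the input qubit that can be reached by applying a channel `Γ` with
qubit output to the output register of `Λ`. -/
def reachableFidelities {n : Type*} [Fintype n] (Λ : Op Qubit →ₗ[ℂ] Op n) : Set ℝ :=
  {f | ∃ Γ : Op n →ₗ[ℂ] Op Qubit, IsCPTP Γ ∧ f = avgFidelity (Γ ∘ₗ Λ)}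

/-- `E` acts as an exact sending channel to prover `p` on the joint states `Ω(|ψ⟩⟨ψ|)`: optimised
over the local operations of `p`, the average fidelity with `ψ` is `1/2` before `E` is applied, and
`1` afterwards. -/
def SendsExactlyOn {r r' : Party → Type*} [∀ p, Fintype (r p)] [∀ p, Fintype (r' p)]
    (p : Party) (Ω : Op Qubit →ₗ[ℂ] Op (Joint r)) (E : Op (Joint r) →ₗ[ℂ] Op (Joint r')) : Prop :=
  IsLUB (reachableFidelities (marginal p ∘ₗ E ∘ₗ Ω)) 1 ∧
    IsLUB (reachableFidelities (marginal p ∘ₗ Ω)) (1 / 2)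

/-- `E` is an exact sending channel to prover `p`. It may be any channel from the registers `r` of
both provers to their registers `r'`; the case where the sender's register is transmitted to a new
register of the receiver, who keeps the old ones, is `E = N ⊗ id`. -/
def IsExactSendingChannel {r r' : Party → Type*} [∀ p, Fintype (r p)] [∀ p, Fintype (r' p)]
    (p : Party) (E : Op (Joint r) →ₗ[ℂ] Op (Joint r')) : Prop :=
  IsCPTP E ∧ ∃ Ω : Op Qubit →ₗ[ℂ] Op (Joint r), IsCPTP Ω ∧ SendsExactlyOn p Ω E

/-! ### Strategies and the test -/

/-- A strategy of the provers in the test of maximal depth `k`. Data at times `> k` is irrelevant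
and unconstrained. -/
structure Strategy (k : ℕ) where
  /-- The register of each prover at each time step. -/
  reg : ℕ → Party → Type
  [regFintype : ∀ κ p, Fintype (reg κ p)]
  /-- The initial private register of `A`. -/
  mem : Type
  [memFintype : Fintype mem]
  /-- At time `0` the system of `A` is the verifier's qubit together with her private register. -/
  input : reg 0 Party.A ≃ Qubit × mem
  /-- The state shared initially by the provers, independent of the verifier's qubit. -/
  shared : Op (mem × reg 0 Party.B)
  shared_isState : IsState shared
  /-- `round j c` is the joint channel applied by the provers between time steps `j` and `j + 1`
  if they are asked to continue up to there and the gates are `c`. -/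
  round : (j : ℕ) → (Fin (j + 1) → Cliff) → Op (Joint (reg j)) →ₗ[ℂ] Op (Joint (reg (j + 1)))
  round_isCPTP : ∀ j < k, ∀ c, IsCPTP (round j c)
  /-- `output κ c` is the local channel by which the holder of the state at time step `κ` produces
  the qubit that is returned to the verifier if the challenge is to output. -/
  output : (κ : ℕ) → (Fin κ → Cliff) → Op (reg κ (holder κ)) →ₗ[ℂ] Op Qubit
  output_isCPTP : ∀ κ, 1 ≤ κ → κ ≤ k → ∀ c, IsCPTP (output κ c)

namespace Strategy

attribute [instance] Strategy.regFintype Strategy.memFintype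

variable {k : ℕ} (S : Strategy k)

/-- The initial joint operator `X ⊗ shared`, where `X` is the operator of the verifier's qubit. -/
def initial : Op Qubit →ₗ[ℂ] Op (Joint (S.reg 0)) where
  toFun X := Matrix.of fun x y =>
    X (S.input x.1).1 (S.input y.1).1 * S.shared ((S.input x.1).2, x.2) ((S.input y.1).2, y.2)
  map_add' X Y := by ext x y; simp [add_mul]
  map_smul' c X := by ext x y; simp [mul_assoc]

/-- The joint operator of the provers at time step `κ`, as a function of the verifier's qubit. -/
def jointState : (κ : ℕ) → (Fin κ → Cliff) → Op Qubit →ₗ[ℂ] Op (Joint (S.reg κ))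
  | 0, _ => S.initial
  | κ + 1, c => S.round κ c ∘ₗ jointState κ (Fin.init c)

/-- The map from the verifier's qubit to the qubit returned after `κ` rounds. -/
def returned (κ : ℕ) (c : Fin κ → Cliff) : Op Qubit →ₗ[ℂ] Op Qubit :=
  S.output κ c ∘ₗ marginal (holder κ) ∘ₗ S.jointState κ c

/-- The probability that the verifier accepts, for given depth, gates and input ket. -/
def acceptProb (κ : ℕ) (c : Fin κ → Cliff) (ψ : EuclideanSpace ℂ Qubit) : ℝ :=
  (S.returned κ c (ketbra ψ) * idealGate κ c (ketbra ψ)).trace.re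

/-- The average probability of success: depth, Pauli eigenstate and gates are uniform. -/
def successProb : ℝ :=
  (1 / (k : ℝ)) * ∑ κ ∈ Finset.Icc 1 k, (1 / 6 : ℝ) * ∑ s : Fin 6,
    (1 / (Fintype.card Cliff : ℝ) ^ κ) * ∑ c : Fin κ → Cliff, S.acceptProb κ c (pauliKet s)

end Strategy

end

end PingPong

namespace PingPong

open Matrix

/-! ### Complete positivity and channels -/

section Channels

variable {l m n : Type*}

/-! The success probability is a nested average of acceptance probabilities, each at most 1, so
`successProb = 1` forces certain acceptance for every depth, gate string and Pauli eigenstate. A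
qubit state passing a pure projection with certainty is that pure state
(`eq_ketbra_of_trace_mul_ketbra`), and the Pauli eigenstates span the operators, so linearity gives
the first claim (`returned_eq_idealGate`).

For the second claim, undoing the Clifford string after the output channel shows that the holder at
time `κ ≥ 1` can recover the verifier's qubit perfectly. This gives supremum 1 after each round.
Before the round, the other prover holds a state independent of the qubit: perfect recovery on one
side leaves no information on the other (`marginal_eq_smul_of_recovery`), and at time 0 the joint
state is a product. A receiver without information can only guess, and every guess has average
fidelity exactly 1/2 because orthogonal kets contribute 1 in pairs (`avgFidelity_replaceBy`).
Holders alternate, so the next holder is always the uninformed prover. -/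

theorem IsCompletelyPositive.comp {Ψ : Op m →ₗ[ℂ] Op n} {Φ : Op l →ₗ[ℂ] Op m}
    (hΨ : IsCompletelyPositive Ψ) (hΦ : IsCompletelyPositive Φ) :
    IsCompletelyPositive (Ψ ∘ₗ Φ) :=
  fun r M hM => hΨ r _ (hΦ r M hM)

theorem IsCPTP.comp [Fintype l] [Fintype m] [Fintype n] {Ψ : Op m →ₗ[ℂ] Op n}
    {Φ : Op l →ₗ[ℂ] Op m} (hΨ : IsCPTP Ψ) (hΦ : IsCPTP Φ) : IsCPTP (Ψ ∘ₗ Φ) :=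
  ⟨hΨ.1.comp hΦ.1, fun M => (hΨ.2 _).trans (hΦ.2 M)⟩

/-- A completely positive map may be ampliated by any finite ancilla. -/
theorem IsCompletelyPositive.posSemidef_ampliate {Φ : Op m →ₗ[ℂ] Op n}
    (hΦ : IsCompletelyPositive Φ) (r : Type*) [Fintype r] {M : Op (m × r)} (hM : M.PosSemidef) :
    (ampliate Φ r M).PosSemidef := by
  let e := Fintype.equivFin r
  have h := (hΦ _ _ (hM.submatrix fun x : m × Fin (Fintype.card r) =>
    (x.1, e.symm x.2))).submatrix fun x : n × r => (x.1, e x.2)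
  convert h using 1
  ext x y
  simp [ampliate]

theorem IsCompletelyPositive.posSemidef {Φ : Op m →ₗ[ℂ] Op n} (hΦ : IsCompletelyPositive Φ)
    {M : Op m} (hM : M.PosSemidef) : (Φ M).PosSemidef :=
  (hΦ 1 _ (hM.submatrix Prod.fst)).submatrix fun i => (i, 0)

theorem isCPTP_conjBy {U : Op Qubit} (hU : Uᴴ * U = 1) : IsCPTP (conjBy U) := by
  refine ⟨fun r M hM => ?_, fun M => ?_⟩
  -- The ampliation is conjugation by `U ⊗ 1`.
  · convert hM.mul_mul_conjTranspose_same (kroneckerMap (· * ·) U (1 : Matrix (Fin r) (Fin r) ℂ))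
      using 1
    ext x y
    simp [ampliate, conjBy, mul_apply, Fintype.sum_prod_type, one_apply, Fin.sum_univ_two,
      apply_ite]
  · change (U * M * Uᴴ).trace = _
    rw [trace_mul_cycle, hU, one_mul]

theorem isCPTP_marginal {r : Party → Type*} [∀ p, Fintype (r p)] (p : Party) :
    IsCPTP (marginal (r := r) p) := by
  cases p
  · refine ⟨fun s M hM => ?_, fun M => ?_⟩
    -- The ampliated partial trace is a sum of principal submatrices, one for each basis vector of
    -- the discarded register.
    · convert posSemidef_sum Finset.univ fun (b : r .B) _ =>
        hM.submatrix fun x : r .A × Fin s => ((x.1, b), x.2) using 1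
      ext x y
      simp [ampliate, marginal, Matrix.sum_apply]
    · simp [marginal, trace, Fintype.sum_prod_type]
  · refine ⟨fun s M hM => ?_, fun M => ?_⟩
    · convert posSemidef_sum Finset.univ fun (a : r .A) _ =>
        hM.submatrix fun x : r .B × Fin s => ((a, x.1), x.2) using 1
      ext x y
      simp [ampliate, marginal, Matrix.sum_apply]
    · simp [marginal, trace, Fintype.sum_prod_type_right]

/-- The channel that discards its input and prepares the operator `σ`. -/
def replaceBy [Fintype m] (σ : Op n) : Op m →ₗ[ℂ] Op n where
  toFun M := M.trace • σ
  map_add' M N := by rw [trace_add, add_smul]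
  map_smul' c M := by rw [trace_smul, smul_assoc, RingHom.id_apply]

theorem isCPTP_replaceBy [Fintype m] [Fintype n] {σ : Op n} (hσ : IsState σ) :
    IsCPTP (replaceBy (m := m) σ) := by
  refine ⟨fun r M hM => ?_, fun M => ?_⟩
  · have h : (∑ i : m, M.submatrix (fun x : Fin r => (i, x)) fun x => (i, x)).PosSemidef :=
      posSemidef_sum Finset.univ fun i _ => hM.submatrix _
    have e : ampliate (replaceBy σ) (Fin r) M = kroneckerMap (· * ·) σ
        (∑ i : m, M.submatrix (fun x : Fin r => (i, x)) fun x => (i, x)) := by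
      ext x y
      simp [ampliate, replaceBy, trace, Matrix.sum_apply, mul_comm]
    rw [e]
    exact hσ.1.kronecker h
  · simp [replaceBy, trace_smul, hσ.2]

end Channels

/-! ### Rank-one projections of a qubit -/

section Kets

/-- The antiunitary map sending a ket of a qubit to an orthogonal one. -/
def spinFlip : EuclideanSpace ℂ Qubit ≃ₗᵢ[ℝ] EuclideanSpace ℂ Qubit where
  toFun v := !₂[-star (v 1), star (v 0)]
  invFun v := !₂[star (v 1), -star (v 0)]
  left_inv v := by ext i; fin_cases i <;> simp
  right_inv v := by ext i; fin_cases i <;> simp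
  map_add' v w := by ext i; fin_cases i <;> simp [add_comm]
  map_smul' c v := by ext i; fin_cases i <;> simp
  norm_map' v := by simp [EuclideanSpace.norm_eq, add_comm]

theorem norm_sq_eq_one {v : EuclideanSpace ℂ Qubit} (hv : ‖v‖ = 1) :
    v 0 * star (v 0) + v 1 * star (v 1) = 1 := by
  have h := EuclideanSpace.norm_sq_eq v
  rw [hv, Fin.sum_univ_two] at h
  have h2 : ((‖v 0‖ : ℂ) ^ 2 + (‖v 1‖ : ℂ) ^ 2) = 1 := by exact_mod_cast h.symm.trans (one_pow 2)
  simpa [Complex.mul_conj, Complex.normSq_eq_norm_sq] using h2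

theorem ketbra_eq_vecMulVec (v : EuclideanSpace ℂ Qubit) :
    ketbra v = vecMulVec v.ofLp (star v.ofLp) := rfl

theorem posSemidef_ketbra (v : EuclideanSpace ℂ Qubit) : (ketbra v).PosSemidef :=
  posSemidef_vecMulVec_self_star _

theorem trace_ketbra {v : EuclideanSpace ℂ Qubit} (hv : ‖v‖ = 1) : (ketbra v).trace = 1 := by
  simpa [trace, ketbra, Fin.sum_univ_two] using norm_sq_eq_one hv

theorem ketbra_add_ketbra_spinFlip {v : EuclideanSpace ℂ Qubit} (hv : ‖v‖ = 1) :
    ketbra v + ketbra (spinFlip v) = 1 := by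
  have h := norm_sq_eq_one hv
  ext i j
  fin_cases i <;> fin_cases j <;>
    simp [ketbra, spinFlip, mul_comm] <;> simp at h <;> linear_combination h

theorem trace_mul_ketbra (M : Op Qubit) (v : EuclideanSpace ℂ Qubit) :
    (M * ketbra v).trace = star v.ofLp ⬝ᵥ M *ᵥ v.ofLp := by
  rw [ketbra_eq_vecMulVec, mul_vecMulVec, trace_vecMulVec, dotProduct_comm]

theorem trace_mul_ketbra_add (M : Op Qubit) {v : EuclideanSpace ℂ Qubit} (hv : ‖v‖ = 1) :
    (M * ketbra v).trace + (M * ketbra (spinFlip v)).trace = M.trace := by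
  rw [← trace_add, ← mul_add, ketbra_add_ketbra_spinFlip hv, mul_one]

theorem trace_mul_ketbra_nonneg {M : Op Qubit} (hM : M.PosSemidef) (v : EuclideanSpace ℂ Qubit) :
    0 ≤ (M * ketbra v).trace := by
  rw [trace_mul_ketbra]
  exact hM.dotProduct_mulVec_nonneg _

theorem re_trace_mul_ketbra_le {M : Op Qubit} (hM : M.PosSemidef) {v : EuclideanSpace ℂ Qubit}
    (hv : ‖v‖ = 1) :
    (M * ketbra v).trace.re ≤ M.trace.re := by
  have h := (Complex.le_def.1 (trace_mul_ketbra_nonneg hM (spinFlip v))).1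
  have h2 := congrArg Complex.re (trace_mul_ketbra_add M hv)
  simp only [Complex.zero_re, Complex.add_re] at h h2
  linarith

/-- A compression to a line is a scalar. Once an operator is known to be fixed by `ketbra v` on both
sides, this makes it a multiple of `ketbra v`. -/
theorem ketbra_mul_mul_ketbra (M : Op Qubit) (v : EuclideanSpace ℂ Qubit) :
    ketbra v * M * ketbra v = (M * ketbra v).trace • ketbra v := by
  rw [trace_mul_ketbra, ketbra_eq_vecMulVec, mul_assoc, mul_vecMulVec, vecMulVec_mul_vecMulVec,
    vecMulVec_smul]

/-- A qubit state that passes the projection onto a pure state with certainty is that state. -/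
theorem eq_ketbra_of_trace_mul_ketbra {σ : Op Qubit} (hσ : IsState σ)
    {v : EuclideanSpace ℂ Qubit} (hv : ‖v‖ = 1) (h : (σ * ketbra v).trace.re = 1) : σ = ketbra v := by
  have h1 := trace_mul_ketbra_add σ hv
  have h0 := trace_mul_ketbra_nonneg hσ.1 (spinFlip v)
  have h0' := trace_mul_ketbra_nonneg hσ.1 v
  have hv1 : (σ * ketbra v).trace = 1 :=
    Complex.ext (by simpa using h) (by simpa using (Complex.le_def.1 h0').2.symm)
  -- The orthogonal ket has expectation 0 in a positive operator, hence lies in its kernel.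
  rw [hσ.2, hv1, add_eq_left, trace_mul_ketbra, hσ.1.dotProduct_mulVec_zero_iff] at h1
  have h2 : σ * ketbra (spinFlip v) = 0 := by
    rw [ketbra_eq_vecMulVec, mul_vecMulVec, h1, zero_vecMulVec]
  have h3 : σ * ketbra v = σ := by
    have := congrArg (σ * ·) (ketbra_add_ketbra_spinFlip hv)
    simpa [mul_add, h2] using this
  have h4 : ketbra v * σ = σ := by
    have := congrArg conjTranspose h3
    rwa [conjTranspose_mul, hσ.1.isHermitian.eq, (posSemidef_ketbra v).isHermitian.eq] at this
  have h5 := ketbra_mul_mul_ketbra σ v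
  rwa [hv1, one_smul, h4, h3] at h5

theorem conjBy_ketbra (U : Op Qubit) (v : EuclideanSpace ℂ Qubit) :
    conjBy U (ketbra v) = ketbra (WithLp.toLp 2 (U *ᵥ v.ofLp)) := by
  change U * _ * Uᴴ = _
  rw [ketbra_eq_vecMulVec, ketbra_eq_vecMulVec, mul_vecMulVec, vecMulVec_mul, star_mulVec]

theorem norm_toLp_mulVec {U : Op Qubit} (hU : Uᴴ * U = 1) (v : EuclideanSpace ℂ Qubit) :
    ‖(WithLp.toLp 2 (U *ᵥ v.ofLp) : EuclideanSpace ℂ Qubit)‖ = ‖v‖ := by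
  have h (w : EuclideanSpace ℂ Qubit) : ((‖w‖ ^ 2 : ℝ) : ℂ) = star w.ofLp ⬝ᵥ w.ofLp := by
    rw [EuclideanSpace.norm_sq_eq]
    simp [dotProduct, Complex.conj_mul']
  rw [← sq_eq_sq₀ (norm_nonneg _) (norm_nonneg _), ← Complex.ofReal_inj, h, h]
  simp only [star_mulVec, dotProduct_mulVec, vecMul_vecMul, hU, vecMul_one]

theorem norm_pauliKet (s : Fin 6) : ‖pauliKet s‖ = 1 := by
  fin_cases s <;> simp [pauliKet, EuclideanSpace.norm_eq] <;> norm_num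

theorem ketbra_pauliKet :
    ketbra (pauliKet 0) = !![1, 0; 0, 0] ∧ ketbra (pauliKet 1) = !![0, 0; 0, 1] ∧
    ketbra (pauliKet 2) = (1 / 2 : ℂ) • !![1, 1; 1, 1] ∧
    ketbra (pauliKet 3) = (1 / 2 : ℂ) • !![1, -1; -1, 1] ∧
    ketbra (pauliKet 4) = (1 / 2 : ℂ) • !![1, -Complex.I; Complex.I, 1] ∧
    ketbra (pauliKet 5) = (1 / 2 : ℂ) • !![1, Complex.I; -Complex.I, 1] := by
  have h : ((√2 : ℝ) : ℂ)⁻¹ * ((√2 : ℝ) : ℂ)⁻¹ = 1 / 2 := by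
    rw [← mul_inv, ← Complex.ofReal_mul, Real.mul_self_sqrt (by norm_num)]
    norm_num
  refine ⟨?_, ?_, ?_, ?_, ?_, ?_⟩ <;> ext i j <;> fin_cases i <;> fin_cases j <;>
    simp [ketbra, pauliKet] <;>
    first
    | linear_combination h
    | linear_combination -h
    | linear_combination Complex.I * h
    | linear_combination -Complex.I * h
    | linear_combination -Complex.I * Complex.I * h - (1 / 2) * Complex.I_mul_I

/-- The Pauli eigenstates span the operators of a qubit. -/
theorem eq_of_agree_on_pauliKet {E : Type*} [AddCommGroup E] [Module ℂ E]
    {Φ Ψ : Op Qubit →ₗ[ℂ] E} (h : ∀ s, Φ (ketbra (pauliKet s)) = Ψ (ketbra (pauliKet s))) :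
    Φ = Ψ := by
  obtain ⟨h0, h1, h2, h3, h4, h5⟩ := ketbra_pauliKet
  refine LinearMap.ext fun M => ?_
  have hM : M = M 0 0 • ketbra (pauliKet 0) + M 1 1 • ketbra (pauliKet 1)
      + ((M 0 1 + M 1 0) / 2) • (ketbra (pauliKet 2) - ketbra (pauliKet 3))
      + (Complex.I * (M 0 1 - M 1 0) / 2) • (ketbra (pauliKet 4) - ketbra (pauliKet 5)) := by
    rw [h0, h1, h2, h3, h4, h5]
    have hI := Complex.I_mul_I
    ext i j
    fin_cases i <;> fin_cases j <;> simp <;>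
      first
      | linear_combination (M 0 1 / 2 - M 1 0 / 2) * hI
      | linear_combination (M 1 0 / 2 - M 0 1 / 2) * hI
  rw [hM]
  simp only [map_add, map_smul, map_sub, h]

/-- A linear map that has every Pauli eigenstate as an eigenvector is a scalar. -/
theorem eq_smul_of_pauliKet_eigenvectors {f : Op Qubit →ₗ[ℂ] Op Qubit} {c : Fin 6 → ℂ}
    (h : ∀ s, f (ketbra (pauliKet s)) = c s • ketbra (pauliKet s)) (X : Op Qubit) :
    f X = c 0 • X := by
  obtain ⟨h0, h1, h2, h3, h4, h5⟩ := ketbra_pauliKet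
  -- The three eigenbases resolve the same identity. Applying `f` to these linear relations and
  -- comparing matrix entries forces all six eigenvalues to agree.
  have e1 : ketbra (pauliKet 0) + ketbra (pauliKet 1) =
      ketbra (pauliKet 2) + ketbra (pauliKet 3) := by
    rw [h0, h1, h2, h3]
    ext i j
    fin_cases i <;> fin_cases j <;> simp <;> norm_num
  have e2 : ketbra (pauliKet 0) + ketbra (pauliKet 1) =
      ketbra (pauliKet 4) + ketbra (pauliKet 5) := by
    rw [h0, h1, h4, h5]
    ext i j
    fin_cases i <;> fin_cases j <;> simp <;> norm_num
  have f1 := congrArg f e1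
  have f2 := congrArg f e2
  simp only [map_add, h] at f1 f2
  rw [h0, h1, h2, h3] at f1
  rw [h0, h1, h4, h5] at f2
  have a1 := congrFun₂ f1 0 0
  have a2 := congrFun₂ f1 1 1
  have a3 := congrFun₂ f1 0 1
  have b1 := congrFun₂ f2 0 0
  have b3 := congrFun₂ f2 0 1
  simp at a1 a2 a3 b1 b3
  have b4 : c 4 = c 5 := by
    have : Complex.I * (c 4 - c 5) = 0 := by linear_combination 2 * b3
    simpa [sub_eq_zero] using this
  have key : ∀ s, c s = c 0 := by
    intro s
    fin_cases s
    · rfl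
    · change c 1 = c 0; linear_combination a2 - a1
    · change c 2 = c 0; linear_combination -a1 - a3
    · change c 3 = c 0; linear_combination -a1 + a3
    · change c 4 = c 0; linear_combination -b1 + b4 / 2
    · change c 5 = c 0; linear_combination -b1 - b4 / 2
  have : f = c 0 • LinearMap.id := eq_of_agree_on_pauliKet fun s => by simp [h, key s]
  rw [this]; rfl

end Kets

open scoped Pointwise in
/-- A linear isometry acts on the unit sphere, preserving its surface measure. -/
theorem measurePreserving_sphereMap {E : Type*} [NormedAddCommGroup E] [InnerProductSpace ℝ E]
    [FiniteDimensional ℝ E] [MeasurableSpace E] [BorelSpace E] (f : E ≃ₗᵢ[ℝ] E) :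
    MeasurePreserving (fun x : Metric.sphere (0 : E) 1 =>
      (⟨f x, by simp⟩ : Metric.sphere (0 : E) 1))
      (volume : Measure E).toSphere (volume : Measure E).toSphere := by
  have hc : Measurable (fun x : Metric.sphere (0 : E) 1 =>
      (⟨f x, by simp⟩ : Metric.sphere (0 : E) 1)) :=
    ((f.continuous.comp continuous_subtype_val).subtype_mk _).measurable
  refine ⟨hc, Measure.ext fun s hs => ?_⟩
  -- The surface measure of a set is, up to a dimensional factor, the volume of the cone over it;
  -- `f` preserves volume and maps cones to cones.
  rw [Measure.map_apply hc hs, Measure.toSphere_apply' _ (hc hs), Measure.toSphere_apply' _ hs,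
    ← f.measurePreserving.measure_preimage_emb f.toHomeomorph.measurableEmbedding
      (Set.Ioo (0 : ℝ) 1 • (Subtype.val '' s))]
  congr 2
  ext x
  simp only [Set.mem_smul, Set.mem_image, Set.mem_preimage, Subtype.exists, exists_and_right,
    exists_eq_right]
  constructor
  · rintro ⟨r, hr, y, ⟨hy, hys⟩, rfl⟩
    exact ⟨r, hr, f y, ⟨by simpa using hy, hys⟩, by simp⟩
  · rintro ⟨r, hr, y, ⟨hy, hys⟩, hxy⟩
    refine ⟨r, hr, f.symm y, ⟨by simpa using hy, by simpa using hys⟩, ?_⟩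
    apply f.injective
    simpa using hxy

/-! ### The Haar average of the fidelity -/

instance : IsProbabilityMeasure haarPure := by
  refine ⟨?_⟩
  rw [haarPure, Measure.smul_apply, smul_eq_mul]
  exact ENNReal.inv_mul_cancel (by
    rw [Ne, Measure.measure_univ_eq_zero]
    exact Measure.toSphere_ne_zero _) (measure_ne_top _ _)

theorem norm_coe_pureQubit (ψ : PureQubit) : ‖(ψ : EuclideanSpace ℂ Qubit)‖ = 1 := by
  simp

theorem continuous_ketbra : Continuous ketbra := by
  refine continuous_matrix fun i j => ?_
  change Continuous fun v : EuclideanSpace ℂ Qubit => v i * star (v j)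
  fun_prop

theorem integrable_fidelity (Λ : Op Qubit →ₗ[ℂ] Op Qubit) :
    Integrable (fun ψ : PureQubit => (Λ (ketbra ψ) * ketbra ψ).trace.re) haarPure := by
  have hk : Continuous fun ψ : PureQubit => ketbra ψ :=
    continuous_ketbra.comp continuous_subtype_val
  have hΛ : Continuous Λ := Λ.continuous_of_finiteDimensional
  have hc : Continuous fun ψ : PureQubit => (Λ (ketbra ψ) * ketbra ψ).trace.re :=
    Complex.continuous_re.comp ((hΛ.comp hk).matrix_mul hk).matrix_trace
  exact hc.integrable_of_hasCompactSupport (HasCompactSupport.of_compactSpace _)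

theorem avgFidelity_id : avgFidelity LinearMap.id = 1 := by
  have h (ψ : PureQubit) : (ketbra ψ * ketbra ψ).trace.re = 1 := by
    have h1 := trace_ketbra (norm_coe_pureQubit ψ)
    have h2 := ketbra_mul_mul_ketbra 1 (ψ : EuclideanSpace ℂ Qubit)
    rw [mul_one, one_mul, h1, one_smul] at h2
    rw [h2, h1, Complex.one_re]
  simp [avgFidelity, h]

theorem avgFidelity_le_one {Λ : Op Qubit →ₗ[ℂ] Op Qubit} (hΛ : IsCPTP Λ) : avgFidelity Λ ≤ 1 := by
  have h : avgFidelity Λ ≤ ∫ _ : PureQubit, (1 : ℝ) ∂haarPure := by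
    refine integral_mono (integrable_fidelity Λ) (integrable_const _) fun ψ => ?_
    have := re_trace_mul_ketbra_le (hΛ.1.posSemidef (posSemidef_ketbra ψ)) (norm_coe_pureQubit ψ)
    rwa [hΛ.2, trace_ketbra (norm_coe_pureQubit ψ), Complex.one_re] at this
  simpa using h

/-- A fixed guess has average fidelity `1 / 2`. -/
theorem avgFidelity_replaceBy {σ : Op Qubit} (hσ : σ.trace = 1) :
    avgFidelity (replaceBy σ) = 1 / 2 := by
  -- `J` swaps orthogonal kets and preserves the measure. The integrand at `ψ` and at `J ψ` adds up
  -- to `σ.trace = 1`, so twice the integral is 1.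
  let J : PureQubit → PureQubit := fun ψ => ⟨spinFlip ψ, by simp⟩
  have hJ : MeasurePreserving J haarPure haarPure :=
    (measurePreserving_sphereMap spinFlip).smul_measure _
  have hemb : MeasurableEmbedding J :=
    (((spinFlip.continuous.comp continuous_subtype_val).subtype_mk _).isClosedEmbedding
      fun x y h => Subtype.ext (spinFlip.injective (congrArg Subtype.val h))).measurableEmbedding
  have hint := integrable_fidelity (replaceBy σ)
  have h1 : ∫ ψ, (replaceBy σ (ketbra (J ψ)) * ketbra (J ψ)).trace.re ∂haarPure =
      avgFidelity (replaceBy σ) :=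
    hJ.integral_comp hemb fun ψ : PureQubit => (replaceBy σ (ketbra ψ) * ketbra ψ).trace.re
  have h2 : avgFidelity (replaceBy σ) + avgFidelity (replaceBy σ) = 1 := by
    nth_rw 2 [← h1]
    have hint' : Integrable (fun ψ => (replaceBy σ (ketbra (J ψ)) * ketbra (J ψ)).trace.re)
        haarPure := hJ.integrable_comp_of_integrable hint
    rw [avgFidelity, ← integral_add hint hint']
    have h (ψ : PureQubit) : (replaceBy σ (ketbra ψ) * ketbra ψ).trace.re +
        (replaceBy σ (ketbra (J ψ)) * ketbra (J ψ)).trace.re = 1 := by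
      change (((ketbra ψ).trace • σ) * ketbra ψ).trace.re +
        (((ketbra (J ψ)).trace • σ) * ketbra (J ψ)).trace.re = 1
      rw [trace_ketbra (norm_coe_pureQubit ψ), trace_ketbra (norm_coe_pureQubit (J ψ)), one_smul,
        ← Complex.add_re, trace_mul_ketbra_add σ (norm_coe_pureQubit ψ), hσ, Complex.one_re]
    simp only [h]
    simp
  linarith

/-! ### No information without disturbance -/

section Disturbance

variable {a b : Type*} [Fintype a] [Fintype b]

/-- A positive operator on a composite register whose marginal on the qubit is the pure state `v` is
a product. -/
theorem apply_eq_of_pure_marginal {M : Op (Qubit × b)} (hM : M.PosSemidef)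
    {v : EuclideanSpace ℂ Qubit} (hv : ‖v‖ = 1)
    (h : (Matrix.of fun i j => ∑ y, M (i, y) (j, y)) = ketbra v) (y y' : b) :
    ∃ c : ℂ, (Matrix.of fun i j => M (i, y) (j, y')) = c • ketbra v := by
  classical
  -- View `M` as a block matrix with qubit blocks. The diagonal blocks are positive and sum to
  -- `ketbra v`, so each annihilates the orthogonal ket `w`; positivity of all of `M` then extends
  -- this to the off-diagonal blocks.
  let B (y y' : b) : Op Qubit := Matrix.of fun i j => M (i, y) (j, y')
  let w := spinFlip v
  have hB (y : b) : (B y y).PosSemidef := hM.submatrix fun i : Qubit => (i, y)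
  have hsum : ∑ y, (B y y * ketbra w).trace = 0 := by
    have e : ∑ y, B y y = ketbra v := by
      rw [← h]
      ext i j
      simp [B, Matrix.sum_apply]
    have h1 := ketbra_mul_mul_ketbra 1 v
    rw [mul_one, one_mul, trace_ketbra hv, one_smul] at h1
    have h2 := trace_mul_ketbra_add (ketbra v) hv
    rw [h1, add_eq_left] at h2
    rw [← trace_sum, ← Finset.sum_mul, e, h2]
  -- The vector is `w ⊗ e_y`; its expectation in `M` is that of `w` in the diagonal block `B y y`.
  have hker (y : b) : M *ᵥ (fun x => if x.2 = y then w.ofLp x.1 else 0) = 0 := by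
    rw [← hM.dotProduct_mulVec_zero_iff]
    have h0 := (Finset.sum_eq_zero_iff_of_nonneg fun y _ => trace_mul_ketbra_nonneg (hB y) w).1
      hsum y (Finset.mem_univ y)
    rw [trace_mul_ketbra] at h0
    refine Eq.trans ?_ h0
    simp [dotProduct, mulVec, Fintype.sum_prod_type, B, apply_ite star]
  have hBw (y y' : b) : B y y' * ketbra w = 0 := by
    have : B y y' *ᵥ w.ofLp = 0 := by
      ext i
      have := congrFun (hker y') (i, y)
      simpa [mulVec, dotProduct, Fintype.sum_prod_type, B] using this
    rw [ketbra_eq_vecMulVec, mul_vecMulVec, this, zero_vecMulVec]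
  have hright (y y' : b) : B y y' * ketbra v = B y y' := by
    have := congrArg (B y y' * ·) (ketbra_add_ketbra_spinFlip hv)
    simpa only [mul_add, w, hBw, add_zero, mul_one] using this
  -- Hermiticity of `M` exchanges `B y y'` with the adjoint of `B y' y`, turning right invariance
  -- into left invariance.
  have hleft : ketbra v * B y y' = B y y' := by
    have e : (B y' y)ᴴ = B y y' := by
      ext i j
      exact hM.isHermitian.apply _ _
    have := congrArg conjTranspose (hright y' y)
    rwa [conjTranspose_mul, (posSemidef_ketbra v).isHermitian.eq, e] at this
  refine ⟨(B y y' * ketbra v).trace, ?_⟩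
  rw [← ketbra_mul_mul_ketbra, hleft, hright]

/-- Apply the recovery `D` to the first register only. On a pure input the result has that pure
state as its qubit marginal, so it is a product and each of its blocks is a multiple of the input. A
block is linear in the input, so the multiple cannot depend on which state was sent. Since `D`
preserves the trace, the traces of these blocks are the entries of the second marginal, which is
therefore constant on states. -/
theorem exists_marginal_eq_smul {Λ : Op Qubit →ₗ[ℂ] Op (a × b)}
    (hΛ : ∀ X, X.PosSemidef → (Λ X).PosSemidef) {D : Op a →ₗ[ℂ] Op Qubit} (hD : IsCPTP D)
    (h : ∀ X, D (Matrix.of fun i j => ∑ y, Λ X (i, y) (j, y)) = X) :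
    ∃ σ : Op b, ∀ X, (Matrix.of fun y y' => ∑ i, Λ X (i, y) (i, y')) = X.trace • σ := by
  -- `f y y'` is the block at `(y, y')` of `(D ⊗ id) ∘ Λ`.
  let f (y y' : b) : Op Qubit →ₗ[ℂ] Op Qubit :=
    D ∘ₗ { toFun := fun X => Matrix.of fun i j => Λ X (i, y) (j, y')
           map_add' := fun X Y => by ext; simp
           map_smul' := fun c X => by ext; simp }
  have hf (X : Op Qubit) (y y' : b) :
      f y y' X = Matrix.of fun i j => ampliate D b (Λ X) (i, y) (j, y') := rfl
  have hpure (v : EuclideanSpace ℂ Qubit) (hv : ‖v‖ = 1) (y y' : b) :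
      ∃ c : ℂ, f y y' (ketbra v) = c • ketbra v := by
    rw [hf]
    refine apply_eq_of_pure_marginal
      (hD.1.posSemidef_ampliate b (hΛ _ (posSemidef_ketbra v))) hv ?_ y y'
    rw [← h (ketbra v)]
    have e : (Matrix.of fun i j => ∑ y, Λ (ketbra v) (i, y) (j, y)) =
        ∑ y, Matrix.of fun i j => Λ (ketbra v) (i, y) (j, y) := by
      ext i j
      simp [Matrix.sum_apply]
    conv_rhs => rw [e, map_sum]
    rw [h]
    ext i j
    simp [Matrix.sum_apply, ampliate]
  choose c hc using fun y y' s => hpure (pauliKet s) (norm_pauliKet s) y y'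
  refine ⟨Matrix.of fun y y' => c y y' 0, fun X => ?_⟩
  ext y y'
  have h1 := congrArg trace (eq_smul_of_pauliKet_eigenvectors (hc y y') X)
  have h2 : (f y y' X).trace = ∑ i, Λ X (i, y) (i, y') := hD.2 _
  rw [h2, trace_smul] at h1
  simpa [mul_comm] using h1

end Disturbance

theorem isState_ketbra {v : EuclideanSpace ℂ Qubit} (hv : ‖v‖ = 1) : IsState (ketbra v) :=
  ⟨posSemidef_ketbra v, trace_ketbra hv⟩

theorem IsCPTP.isState {m n : Type*} [Fintype m] [Fintype n] {Φ : Op m →ₗ[ℂ] Op n}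
    (hΦ : IsCPTP Φ) {ρ : Op m} (hρ : IsState ρ) : IsState (Φ ρ) :=
  ⟨hΦ.1.posSemidef hρ.1, (hΦ.2 ρ).trans hρ.2⟩

/-- If one prover can recover the qubit from a joint state, the state of the other prover carries no
information about it. -/
theorem marginal_eq_smul_of_recovery {r : Party → Type*} [∀ p, Fintype (r p)]
    {Λ : Op Qubit →ₗ[ℂ] Op (Joint r)} (hΛ : IsCPTP Λ) {p q : Party} (hpq : p ≠ q)
    {D : Op (r q) →ₗ[ℂ] Op Qubit} (hD : IsCPTP D) (h : ∀ X, D (marginal q (Λ X)) = X) :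
    ∃ σ : Op (r p), marginal p ∘ₗ Λ = replaceBy σ := by
  cases p <;> cases q <;> try exact absurd rfl hpq
  -- The registers are swapped so that the recovering prover comes first.
  · let Λ' : Op Qubit →ₗ[ℂ] Op (r .B × r .A) :=
      { toFun := fun X => (Λ X).submatrix Prod.swap Prod.swap
        map_add' := fun X Y => by rw [map_add]; rfl
        map_smul' := fun c X => by rw [map_smul]; rfl }
    obtain ⟨σ, hσ⟩ := exists_marginal_eq_smul (Λ := Λ')
      (fun X hX => (hΛ.1.posSemidef hX).submatrix _) hD h
    exact ⟨σ, LinearMap.ext hσ⟩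
  · obtain ⟨σ, hσ⟩ := exists_marginal_eq_smul (fun X hX => hΛ.1.posSemidef hX) hD h
    exact ⟨σ, LinearMap.ext hσ⟩

/-- Any channel applied after a constant preparation is again a constant preparation, so the set of
reachable fidelities is the single value 1/2. -/
theorem isLUB_reachableFidelities_replaceBy {n : Type*} [Fintype n] {σ : Op n}
    (hσ : σ.trace = 1) : IsLUB (reachableFidelities (replaceBy σ)) (1 / 2) := by
  have key (Γ : Op n →ₗ[ℂ] Op Qubit) (hΓ : IsCPTP Γ) :
      avgFidelity (Γ ∘ₗ replaceBy σ) = 1 / 2 := by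
    have e : Γ ∘ₗ replaceBy (m := Qubit) σ = replaceBy (Γ σ) :=
      LinearMap.ext fun X => map_smul Γ X.trace σ
    rw [e, avgFidelity_replaceBy ((hΓ.2 σ).trans hσ)]
  refine IsGreatest.isLUB ⟨?_, ?_⟩
  · have hΓ := isCPTP_replaceBy (m := n) (isState_ketbra (norm_pauliKet 0))
    exact ⟨_, hΓ, (key _ hΓ).symm⟩
  · rintro _ ⟨Γ, hΓ, rfl⟩
    exact (key Γ hΓ).le

theorem isLUB_reachableFidelities_one {n : Type*} [Fintype n] {Λ : Op Qubit →ₗ[ℂ] Op n}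
    (hΛ : IsCPTP Λ) {D : Op n →ₗ[ℂ] Op Qubit} (hD : IsCPTP D) (h : D ∘ₗ Λ = LinearMap.id) :
    IsLUB (reachableFidelities Λ) 1 := by
  refine IsGreatest.isLUB ⟨⟨D, hD, ?_⟩, ?_⟩
  · rw [h, avgFidelity_id]
  · rintro _ ⟨Γ, hΓ, rfl⟩
    exact avgFidelity_le_one (hΓ.comp hΛ)

/-! ### Clifford strings -/

theorem idealGate_eq_conjBy (κ : ℕ) (c : Fin κ → Cliff) :
    ∃ U : Op Qubit, Uᴴ * U = 1 ∧ idealGate κ c = conjBy U := by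
  induction κ with
  | zero => exact ⟨1, by simp, LinearMap.ext fun M => by simp [idealGate, conjBy]⟩
  | succ κ ih =>
    obtain ⟨U, hU, h⟩ := ih (Fin.init c)
    obtain ⟨V, hV, hΦ⟩ := (c (Fin.last κ)).2
    have hV' : Vᴴ * V = 1 := mem_unitaryGroup_iff'.1 hV.1
    refine ⟨V * U, ?_, ?_⟩
    · rw [conjTranspose_mul, mul_assoc, ← mul_assoc Vᴴ, hV', one_mul, hU]
    · rw [idealGate, hΦ, h]
      refine LinearMap.ext fun M => ?_
      simp [conjBy, mul_assoc, conjTranspose_mul]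

theorem exists_idealGate_ketbra (κ : ℕ) (c : Fin κ → Cliff) {v : EuclideanSpace ℂ Qubit}
    (hv : ‖v‖ = 1) : ∃ w, ‖w‖ = 1 ∧ idealGate κ c (ketbra v) = ketbra w := by
  obtain ⟨U, hU, h⟩ := idealGate_eq_conjBy κ c
  exact ⟨_, (norm_toLp_mulVec hU v).trans hv, by rw [h, conjBy_ketbra]⟩

theorem exists_isCPTP_inverse_idealGate (κ : ℕ) (c : Fin κ → Cliff) :
    ∃ R : Op Qubit →ₗ[ℂ] Op Qubit, IsCPTP R ∧ R ∘ₗ idealGate κ c = LinearMap.id := by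
  obtain ⟨U, hU, h⟩ := idealGate_eq_conjBy κ c
  have hU' : U * Uᴴ = 1 := mul_eq_one_comm.1 hU
  refine ⟨conjBy Uᴴ, isCPTP_conjBy (by rwa [conjTranspose_conjTranspose]), ?_⟩
  rw [h]
  refine LinearMap.ext fun M => ?_
  change Uᴴ * (U * M * Uᴴ) * Uᴴᴴ = M
  rw [conjTranspose_conjTranspose, mul_assoc, mul_assoc, hU, mul_one, ← mul_assoc, hU, one_mul]

/-! ### Averages -/

theorem average_le_one {ι : Type*} {s : Finset ι} {f : ι → ℝ} (hf : ∀ i ∈ s, f i ≤ 1) :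
    1 / (s.card : ℝ) * ∑ i ∈ s, f i ≤ 1 := by
  have h := Finset.sum_le_card_nsmul s f 1 hf
  rw [nsmul_eq_mul, mul_one] at h
  rw [one_div_mul_eq_div]
  exact div_le_one_of_le₀ h (Nat.cast_nonneg _)

theorem eq_one_of_average_eq_one {ι : Type*} {s : Finset ι} {f : ι → ℝ}
    (hf : ∀ i ∈ s, f i ≤ 1) (h : 1 / (s.card : ℝ) * ∑ i ∈ s, f i = 1) : ∀ i ∈ s, f i = 1 := by
  -- With division by zero equal to zero, an average over the empty set is 0 and not 1.
  have hc : (s.card : ℝ) ≠ 0 := by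
    intro h0
    simp [h0] at h
  rw [one_div_mul_eq_div, div_eq_one_iff_eq hc] at h
  exact (Finset.sum_eq_sum_iff_of_le hf).1 (by simpa using h)

/-! ### Strategies -/

namespace Strategy

variable {k : ℕ} (S : Strategy k)

theorem isCPTP_initial : IsCPTP S.initial := by
  refine ⟨fun r M hM => ?_, fun M => ?_⟩
  · exact (hM.kronecker S.shared_isState.1).submatrix
      (fun x : Joint (S.reg 0) × Fin r =>
        (((S.input x.1.1).1, x.2), ((S.input x.1.1).2, x.1.2)))
  · have h := S.shared_isState.2
    simp only [trace, diag_apply, Fintype.sum_prod_type] at h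
    calc (S.initial M).trace
        = ∑ x, ∑ y, M (S.input x).1 (S.input x).1 * S.shared ((S.input x).2, y) ((S.input x).2, y) := by
          simp [initial, trace, Fintype.sum_prod_type]
      _ = ∑ x : Qubit × S.mem, ∑ y, M x.1 x.1 * S.shared (x.2, y) (x.2, y) :=
          Equiv.sum_comp S.input fun x => ∑ y, M x.1 x.1 * S.shared (x.2, y) (x.2, y)
      _ = M.trace := by
          simp only [Fintype.sum_prod_type, ← Finset.mul_sum, h, mul_one]
          rfl

theorem isCPTP_jointState {κ : ℕ} (hκ : κ ≤ k) (c : Fin κ → Cliff) :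
    IsCPTP (S.jointState κ c) := by
  induction κ with
  | zero => exact S.isCPTP_initial
  | succ κ ih => exact (S.round_isCPTP κ hκ c).comp (ih (by omega) _)

theorem isCPTP_returned {κ : ℕ} (h1 : 1 ≤ κ) (hκ : κ ≤ k) (c : Fin κ → Cliff) :
    IsCPTP (S.returned κ c) :=
  (S.output_isCPTP κ h1 hκ c).comp ((isCPTP_marginal _).comp (S.isCPTP_jointState hκ c))

theorem acceptProb_le_one {κ : ℕ} (h1 : 1 ≤ κ) (hκ : κ ≤ k) (c : Fin κ → Cliff)
    {v : EuclideanSpace ℂ Qubit} (hv : ‖v‖ = 1) : S.acceptProb κ c v ≤ 1 := by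
  obtain ⟨w, hw, h⟩ := exists_idealGate_ketbra κ c hv
  have hst := (S.isCPTP_returned h1 hκ c).isState (isState_ketbra hv)
  have := re_trace_mul_ketbra_le hst.1 hw
  rwa [hst.2, Complex.one_re, ← h] at this

theorem acceptProb_eq_one (hwin : S.successProb = 1) {κ : ℕ} (h1 : 1 ≤ κ) (hκ : κ ≤ k)
    (c : Fin κ → Cliff) (s : Fin 6) : S.acceptProb κ c (pauliKet s) = 1 := by
  -- The success probability is rewritten as three nested averages with cardinality weights, so that
  -- the equality case of the average bound peels off depth, state and gates in turn.
  let f (κ : ℕ) (s : Fin 6) : ℝ := 1 / ((Finset.univ : Finset (Fin κ → Cliff)).card : ℝ) *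
    ∑ c : Fin κ → Cliff, S.acceptProb κ c (pauliKet s)
  let g (κ : ℕ) : ℝ := 1 / ((Finset.univ : Finset (Fin 6)).card : ℝ) * ∑ s : Fin 6, f κ s
  have hacc : ∀ κ ∈ Finset.Icc 1 k, ∀ s, ∀ c ∈ (Finset.univ : Finset (Fin κ → Cliff)),
      S.acceptProb κ c (pauliKet s) ≤ 1 := fun κ hκ s c _ =>
    S.acceptProb_le_one (Finset.mem_Icc.1 hκ).1 (Finset.mem_Icc.1 hκ).2 c (norm_pauliKet s)
  have hf : ∀ κ ∈ Finset.Icc 1 k, ∀ s ∈ (Finset.univ : Finset (Fin 6)), f κ s ≤ 1 :=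
    fun κ hκ s _ => average_le_one (hacc κ hκ s)
  have hg : ∀ κ ∈ Finset.Icc 1 k, g κ ≤ 1 := fun κ hκ => average_le_one (hf κ hκ)
  have hwin' : 1 / ((Finset.Icc 1 k).card : ℝ) * ∑ κ ∈ Finset.Icc 1 k, g κ = 1 := by
    simpa [successProb, g, f] using hwin
  have hm : κ ∈ Finset.Icc 1 k := Finset.mem_Icc.2 ⟨h1, hκ⟩
  exact eq_one_of_average_eq_one (hacc κ hm s) (eq_one_of_average_eq_one (hf κ hm)
    (eq_one_of_average_eq_one hg hwin' κ hm) s (Finset.mem_univ s)) c (Finset.mem_univ c)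

theorem returned_eq_idealGate (hwin : S.successProb = 1) {κ : ℕ} (h1 : 1 ≤ κ) (hκ : κ ≤ k)
    (c : Fin κ → Cliff) : S.returned κ c = idealGate κ c := by
  refine eq_of_agree_on_pauliKet fun s => ?_
  obtain ⟨w, hw, h⟩ := exists_idealGate_ketbra κ c (norm_pauliKet s)
  have hacc := S.acceptProb_eq_one hwin h1 hκ c s
  rw [acceptProb, h] at hacc
  rw [h]
  exact eq_ketbra_of_trace_mul_ketbra
    ((S.isCPTP_returned h1 hκ c).isState (isState_ketbra (norm_pauliKet s))) hw hacc

/-- The holder of the state can recover the verifier's qubit. -/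
theorem exists_recovery (hwin : S.successProb = 1) {κ : ℕ} (h1 : 1 ≤ κ) (hκ : κ ≤ k)
    (c : Fin κ → Cliff) : ∃ D : Op (S.reg κ (holder κ)) →ₗ[ℂ] Op Qubit,
      IsCPTP D ∧ D ∘ₗ marginal (holder κ) ∘ₗ S.jointState κ c = LinearMap.id := by
  obtain ⟨R, hR, hR'⟩ := exists_isCPTP_inverse_idealGate κ c
  refine ⟨R ∘ₗ S.output κ c, hR.comp (S.output_isCPTP κ h1 hκ c), ?_⟩
  rw [← hR', ← S.returned_eq_idealGate hwin h1 hκ c]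
  rfl

theorem marginal_initial : ∃ σ, marginal Party.B ∘ₗ S.initial = replaceBy σ := by
  refine ⟨Matrix.of fun y y' => ∑ x, S.shared (x, y) (x, y'), LinearMap.ext fun X => ?_⟩
  ext y y'
  calc (marginal Party.B (S.initial X)) y y'
      = ∑ x, X (S.input x).1 (S.input x).1 * S.shared ((S.input x).2, y) ((S.input x).2, y') := rfl
    _ = ∑ x : Qubit × S.mem, X x.1 x.1 * S.shared (x.2, y) (x.2, y') :=
        Equiv.sum_comp S.input fun x => X x.1 x.1 * S.shared (x.2, y) (x.2, y')
    _ = X.trace * ∑ x, S.shared (x, y) (x, y') := by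
        simp only [Fintype.sum_prod_type, ← Finset.mul_sum, ← Finset.sum_mul]
        rfl

theorem marginal_jointState (hwin : S.successProb = 1) {j : ℕ} (hj : j ≤ k) (c : Fin j → Cliff)
    {p : Party} (hp : p ≠ holder j) :
    ∃ σ, marginal p ∘ₗ S.jointState j c = replaceBy σ := by
  -- The test never asks for an output at time 0, so no recovery channel is available from it there;
  -- the product form of the initial state takes its place.
  rcases Nat.eq_zero_or_pos j with rfl | h1
  · cases p
    · simp [holder] at hp
    · exact S.marginal_initial
  · obtain ⟨D, hD, h⟩ := S.exists_recovery hwin h1 hj c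
    exact marginal_eq_smul_of_recovery (S.isCPTP_jointState hj c) hp hD (LinearMap.congr_fun h)

theorem sendsExactlyOn (hwin : S.successProb = 1) {j : ℕ} (hj : j < k)
    (c : Fin (j + 1) → Cliff) :
    SendsExactlyOn (holder (j + 1)) (S.jointState j (Fin.init c)) (S.round j c) := by
  constructor
  · obtain ⟨D, hD, h⟩ := S.exists_recovery hwin (Nat.succ_pos j) hj c
    exact isLUB_reachableFidelities_one
      ((isCPTP_marginal _).comp (S.isCPTP_jointState (κ := j + 1) hj c)) hD h
  · have hp : holder (j + 1) ≠ holder j := by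
      by_cases h : Even j <;> simp [holder, h, Nat.even_add_one]
    obtain ⟨σ, hσ⟩ := S.marginal_jointState hwin hj.le (Fin.init c) hp
    rw [hσ]
    refine isLUB_reachableFidelities_replaceBy ?_
    -- The trace of `σ` is read off by feeding in one normalised state.
    have h := ((isCPTP_marginal (holder (j + 1))).comp
      (S.isCPTP_jointState hj.le (Fin.init c))).2 (ketbra (pauliKet 0))
    rw [hσ, trace_ketbra (norm_pauliKet 0)] at h
    simpa [replaceBy, trace_ketbra (norm_pauliKet 0)] using h

end Strategy

end PingPong

theorem mainTheorem1 (k : ℕ) (S : PingPong.Strategy k) (hwin : S.successProb = 1) :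
    -- the correct rotated state is returned at every depth, for every input
    (∀ κ, 1 ≤ κ → κ ≤ k → ∀ (c : Fin κ → PingPong.Cliff) (X : PingPong.Op PingPong.Qubit),
      S.returned κ c X = PingPong.idealGate κ c X) ∧
    -- in each of the `k` rounds the channel used is an exact sending channel towards the prover
    -- who is to hold the state after the round, and it acts as such on the provers' actual state
    (∀ j < k, ∀ c : Fin (j + 1) → PingPong.Cliff,
      PingPong.IsExactSendingChannel (PingPong.holder (j + 1)) (S.round j c) ∧
      PingPong.SendsExactlyOn (PingPong.holder (j + 1)) (S.jointState j (Fin.init c))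
        (S.round j c)) :=
  ⟨fun _ h1 hκ c X => LinearMap.congr_fun (S.returned_eq_idealGate hwin h1 hκ c) X,
    fun _ hj c => ⟨⟨S.round_isCPTP _ hj c, _, S.isCPTP_jointState hj.le _,
      S.sendsExactlyOn hwin hj c⟩, S.sendsExactlyOn hwin hj c⟩⟩
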